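/- Let $N\ge 2$, let $\mathbb P_t=\mathcal N(\mu_t,\sigma_t^2)$ be a normal distribution on $\mathbb R$ (the true distribution of the residual $w_t$; the degenerate case $\sigma_t^2=0$, a point mass, is allowed), and let $\mathcal S_t=(w_t^1,\dots,w_t^N)$ be drawn from the $N$-fold product distribution $\mathbf P_{\mathcal S_t}=\mathbb P_t^{\otimes N}$. Denote by $\widehat\mu_t=\frac1N\sum_{k=1}^N w_t^k$ and $\widehat\sigma_t^2=\frac1{N-1}\sum_{k=1}^N (w_t^k-\widehat\mu_t)^2$ the empirical mean and variance. Let $\delta^{\mathrm{st}}_t,\delta^{\chi}_t\in(0,1)$. For $p\in(0,1)$ let $q^{\chi}_{N-1}(p)$ and $q^{\mathrm{st}}_{N}(p)$ be the upper-tail quantiles of the chi-square distribution and of Student's $t$-distribution, each with $N-1$ degrees of freedom, that is, the number $x$ with $\Pr(X>x)=p$ for $X$ of the respective distribution. Put $$\underline\sigma_t^2=\frac{(N-1)\widehat\sigma_t^2}{q^{\chi}_{N-1}(\delta^{\chi}_t/2)},\quad \overline\sigma_t^2=\frac{(N-1)\widehat\sigma_t^2}{q^{\chi}_{N-1}(1-\delta^{\chi}_t/2)},\quad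 \overline\mu_t=\widehat\mu_t+q^{\mathrm{st}}_{N}(\delta^{\mathrm{st}}_t/2)\sqrt{\widehat\sigma_t^2/N},\quad \underline\mu_t=\widehat\mu_t-q^{\mathrm{st}}_{N}(\delta^{\mathrm{st}}_t/2)\sqrt{\widehat\sigma_t^2/N},$$ and define the ambiguity set $$\mathcal P_t=\{\mathcal N(\mu,\sigma^2):\ \underline\mu_t\le\mu\le\overline\mu_t,\ \underline\sigma_t^2\le\sigma^2\le\overline\sigma_t^2\}.$$ Then the event $\{\mathbb P_t\in\mathcal P_t\}$ is measurable and $$\mathbf P_{\mathcal S_t}\big(\mathbb P_t\in\mathcal P_t\big)\ \ge\ 1-\delta_t,\qquad \delta_t=\delta^{\mathrm{st}}_t+\delta^{\chi}_t .$$ -/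

import Mathlib

open MeasureTheory ProbabilityTheory

open scoped NNReal

namespace GaussianAmbiguity

/-- The chi-square distribution with `k` degrees of freedom: the law of the sum of the squares of
`k` independent standard normal random variables. -/
noncomputable def chiSquare (k : ℕ) : Measure ℝ :=
  (Measure.pi (fun _ : Fin k => gaussianReal 0 1)).map (fun z => ∑ i, z i ^ 2)

/-- Student's t-distribution with `k` degrees of freedom: the law of `Z / √(V / k)`, where `Z` is
standard normal, `V` is chi-square with `k` degrees of freedom, and `Z`, `V` are independent. -/
noncomputable def studentT (k : ℕ) : Measure ℝ :=
  ((gaussianReal 0 1).prod (chiSquare k)).map (fun p => p.1 / √(p.2 / k))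

/-- The upper-tail quantile function of a distribution `P` on `ℝ`: the least `x` such that
`P(X > x) ≤ p`. If the cdf of `P` is continuous and `0 < p < 1`, then `P(X > x) = p` at this `x`. -/
noncomputable def upperQuantile (P : Measure ℝ) (p : ℝ) : ℝ :=
  sInf {x : ℝ | P.real (Set.Ioi x) ≤ p}

/-- The empirical mean of the sample `w`. -/
noncomputable def sampleMean {N : ℕ} (w : Fin N → ℝ) : ℝ :=
  (∑ k, w k) / N

/-- The (unbiased) empirical variance of the sample `w`. -/
noncomputable def sampleVar {N : ℕ} (w : Fin N → ℝ) : ℝ :=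
  (∑ k, (w k - sampleMean w) ^ 2) / ((N : ℝ) - 1)

/-- The lower bound on the variance. -/
noncomputable def varLower {N : ℕ} (δχ : ℝ) (w : Fin N → ℝ) : ℝ :=
  ((N : ℝ) - 1) * sampleVar w / upperQuantile (chiSquare (N - 1)) (δχ / 2)

/-- The upper bound on the variance. -/
noncomputable def varUpper {N : ℕ} (δχ : ℝ) (w : Fin N → ℝ) : ℝ :=
  ((N : ℝ) - 1) * sampleVar w / upperQuantile (chiSquare (N - 1)) (1 - δχ / 2)

/-- The lower bound on the mean. -/
noncomputable def meanLower {N : ℕ} (δst : ℝ) (w : Fin N → ℝ) : ℝ :=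
  sampleMean w - upperQuantile (studentT (N - 1)) (δst / 2) * √(sampleVar w / N)

/-- The upper bound on the mean. -/
noncomputable def meanUpper {N : ℕ} (δst : ℝ) (w : Fin N → ℝ) : ℝ :=
  sampleMean w + upperQuantile (studentT (N - 1)) (δst / 2) * √(sampleVar w / N)

/-- The ambiguity set built from the sample `w`: all normal distributions whose mean and variance
lie between the respective bounds. -/
def ambiguitySet {N : ℕ} (δst δχ : ℝ) (w : Fin N → ℝ) : Set (Measure ℝ) :=
  {P | ∃ (m : ℝ) (v : ℝ≥0), P = gaussianReal m v ∧
    meanLower δst w ≤ m ∧ m ≤ meanUpper δst w ∧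
    varLower δχ w ≤ (v : ℝ) ∧ (v : ℝ) ≤ varUpper δχ w}

end GaussianAmbiguity

/-!
Write the sample as `w k = μ + √v * z k` with `z` standard normal. Choose an orthonormal basis whose
first vector is `(1, …, 1) / √N`. By rotation invariance the coordinates of `z` in it are again
independent standard normal; the first one is `√N` times the empirical mean, and the squares of the
others sum to the sum of squared deviations. Hence these two statistics have joint law
`N(0, 1) ⊗ χ²_{N-1}` (`map_meanAndDeviation`), and their Student ratio has law `t_{N-1}`.

The normal law with parameters `μ`, `v` lies in the ambiguity set as soon as both pivotal quantities
lie between their quantiles (`mem_ambiguitySet_of_pivots`), which includes the degenerate case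
`v = 0`. This fails in four tail events, of total probability at most `δst + δχ`
(`measureReal_pivot_tails_le`). The tail bounds at the quantiles hold for every probability measure
(`measureReal_Ioi_upperQuantile_le`, `measureReal_Iio_upperQuantile_le`), so continuity of the
chi-square and Student cdfs is not needed; the lower Student tail reduces to the upper one by
symmetry of the distribution.
-/

namespace GaussianAmbiguity

open Filter Topology

/-! ### Tail bounds at the upper quantile -/

section Quantile

variable {P : Measure ℝ} [IsProbabilityMeasure P] {p : ℝ}

lemma measureReal_Ioi_eq_one_sub_cdf (x : ℝ) : P.real (Set.Ioi x) = 1 - cdf P x := by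
  rw [cdf_eq_real, ← Set.compl_Iic, probReal_compl_eq_one_sub measurableSet_Iic]

lemma measureReal_Ioi_antitone : Antitone fun x : ℝ => P.real (Set.Ioi x) :=
  fun _ _ h => measureReal_mono (Set.Ioi_subset_Ioi h)

lemma exists_measureReal_Ioi_le (hp : 0 < p) : ∃ x : ℝ, P.real (Set.Ioi x) ≤ p := by
  obtain ⟨x, hx⟩ := ((tendsto_cdf_atTop P).eventually (lt_mem_nhds (sub_lt_self 1 hp))).exists
  exact ⟨x, by rw [measureReal_Ioi_eq_one_sub_cdf]; linarith⟩

lemma bddBelow_measureReal_Ioi_le (hp : p < 1) : BddBelow {x : ℝ | P.real (Set.Ioi x) ≤ p} := by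
  obtain ⟨x, hx⟩ := ((tendsto_cdf_atBot P).eventually (gt_mem_nhds (sub_pos.2 hp))).exists
  refine ⟨x, fun y hy => le_of_not_gt fun hyx => ?_⟩
  have h := measureReal_Ioi_antitone (P := P) hyx.le
  simp only [Set.mem_ofPred_eq, measureReal_Ioi_eq_one_sub_cdf] at hy h
  linarith

/-- The infimum defining the upper quantile is attained, by right continuity of the cdf. -/
lemma measureReal_Ioi_upperQuantile_le (hp : 0 < p) :
    P.real (Set.Ioi (upperQuantile P p)) ≤ p := by
  set q := upperQuantile P p with hq
  have hlim : Tendsto (cdf P) (𝓝[>] q) (𝓝 (cdf P q)) :=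
    ((cdf P).right_continuous q).tendsto.mono_left (nhdsWithin_mono _ Set.Ioi_subset_Ici_self)
  have hle : 1 - p ≤ cdf P q := by
    refine ge_of_tendsto hlim ?_
    filter_upwards [self_mem_nhdsWithin] with x hx
    obtain ⟨s, hs, hsx⟩ := exists_lt_of_csInf_lt (exists_measureReal_Ioi_le hp) (hq ▸ hx)
    have h := measureReal_Ioi_antitone (P := P) hsx.le
    replace hs : P.real (Set.Ioi s) ≤ p := hs
    simp only [measureReal_Ioi_eq_one_sub_cdf] at hs h
    linarith
  rw [measureReal_Ioi_eq_one_sub_cdf]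
  linarith

lemma measureReal_Iio_upperQuantile_le (hp : p < 1) :
    P.real (Set.Iio (upperQuantile P p)) ≤ 1 - p := by
  set q := upperQuantile P p with hq
  have hIio : P (Set.Iio q) = ENNReal.ofReal (Function.leftLim (cdf P) q) := by
    conv_lhs => rw [← measure_cdf P]
    simp [(cdf P).measure_Iio (tendsto_cdf_atBot P)]
  have hle : Function.leftLim (cdf P) q ≤ 1 - p := by
    refine le_of_tendsto ((monotone_cdf P).tendsto_leftLim q) ?_
    filter_upwards [self_mem_nhdsWithin] with x hx
    have h := notMem_of_lt_csInf (hq ▸ hx : x < upperQuantile P p) (bddBelow_measureReal_Ioi_le hp)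
    simp only [Set.mem_ofPred_eq, measureReal_Ioi_eq_one_sub_cdf] at h
    linarith
  rw [measureReal_def, hIio]
  exact ENNReal.toReal_le_of_le_ofReal (by linarith) (ENNReal.ofReal_le_ofReal hle)

lemma upperQuantile_pos (hpos : ∀ᵐ x ∂P, 0 < x) (hp₀ : 0 < p) (hp₁ : p < 1) :
    0 < upperQuantile P p := by
  by_contra! h
  have h1 : P.real (Set.Ioi 0) = 1 := by
    rw [measureReal_def, (mem_ae_iff_prob_eq_one measurableSet_Ioi).1 hpos, ENNReal.toReal_one]
  have := measureReal_Ioi_antitone (P := P) h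
  have := measureReal_Ioi_upperQuantile_le (P := P) hp₀
  linarith

end Quantile

/-! ### The chi-square and Student distributions -/

lemma measurable_sum_sq {ι : Type*} [Fintype ι] : Measurable fun z : ι → ℝ => ∑ i, z i ^ 2 := by
  fun_prop

instance isProbabilityMeasure_chiSquare (k : ℕ) : IsProbabilityMeasure (chiSquare k) :=
  Measure.isProbabilityMeasure_map measurable_sum_sq.aemeasurable

lemma measurable_studentRatio (k : ℕ) : Measurable fun p : ℝ × ℝ => p.1 / √(p.2 / k) := by
  fun_prop

instance isProbabilityMeasure_studentT (k : ℕ) : IsProbabilityMeasure (studentT k) :=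
  Measure.isProbabilityMeasure_map (measurable_studentRatio k).aemeasurable

lemma chiSquare_pos_ae {k : ℕ} (hk : 0 < k) : ∀ᵐ x ∂chiSquare k, 0 < x := by
  rw [chiSquare, ae_map_iff measurable_sum_sq.aemeasurable measurableSet_Ioi]
  have hne : ∀ᵐ z ∂Measure.pi (fun _ : Fin k => gaussianReal 0 1), z ⟨0, hk⟩ ≠ 0 := by
    have := nullSingletonClass_gaussianReal (μ := 0) (one_ne_zero (α := ℝ≥0))
    exact (measurePreserving_eval (fun _ : Fin k => gaussianReal 0 1)
      ⟨0, hk⟩).quasiMeasurePreserving.ae (p := fun x => x ≠ 0) (by simp [ae_iff])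
  filter_upwards [hne] with z hz
  exact Finset.sum_pos' (fun i _ => sq_nonneg _) ⟨⟨0, hk⟩, Finset.mem_univ _, by positivity⟩

lemma studentT_map_neg (k : ℕ) : (studentT k).map (fun x => -x) = studentT k := by
  have hG : (gaussianReal 0 1).map (fun x => -x) = gaussianReal 0 1 := by
    simp [gaussianReal_map_neg]
  have hprod : ((gaussianReal 0 1).prod (chiSquare k)).map (Prod.map (fun x => -x) id)
      = (gaussianReal 0 1).prod (chiSquare k) := by
    rw [← Measure.map_prod_map _ _ measurable_neg measurable_id, hG, Measure.map_id]
  conv_rhs => rw [studentT, ← hprod]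
  rw [studentT, Measure.map_map measurable_neg (measurable_studentRatio k),
    Measure.map_map (measurable_studentRatio k) (by fun_prop)]
  congr 1
  ext p
  simp [neg_div]

lemma studentT_Iio_neg (k : ℕ) (x : ℝ) :
    (studentT k).real (Set.Iio (-x)) = (studentT k).real (Set.Ioi x) := by
  conv_rhs => rw [← studentT_map_neg k]
  rw [map_measureReal_apply measurable_neg measurableSet_Ioi]
  congr 1
  ext y
  simp

/-! ### Joint law of the empirical mean and the sum of squared deviations -/

/-- The empirical mean, scaled by the square root of the sample size, and the sum of the squared
deviations from the empirical mean. -/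
noncomputable def meanAndDeviation {N : ℕ} (z : Fin N → ℝ) : ℝ × ℝ :=
  (√N * sampleMean z, ∑ k, (z k - sampleMean z) ^ 2)

lemma measurable_sampleMean {N : ℕ} : Measurable (sampleMean (N := N)) := by
  unfold sampleMean; fun_prop

lemma measurable_sampleVar {N : ℕ} : Measurable (sampleVar (N := N)) := by
  have := measurable_sampleMean (N := N)
  unfold sampleVar; fun_prop

lemma measurable_meanAndDeviation {N : ℕ} : Measurable (meanAndDeviation (N := N)) := by
  have := measurable_sampleMean (N := N)
  unfold meanAndDeviation; fun_prop

lemma sum_sq_sub_sampleMean {N : ℕ} (hN : N ≠ 0) (z : Fin N → ℝ) :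
    ∑ k, (z k - sampleMean z) ^ 2 = ∑ k, z k ^ 2 - N * sampleMean z ^ 2 := by
  have hN' : (N : ℝ) ≠ 0 := by exact_mod_cast hN
  have hs : ∑ k, z k = N * sampleMean z := by rw [sampleMean]; field_simp
  simp only [sub_sq, Finset.sum_add_distrib, Finset.sum_sub_distrib, ← Finset.sum_mul,
    ← Finset.mul_sum, hs, Finset.sum_const, Finset.card_univ, Fintype.card_fin, nsmul_eq_mul]
  ring

/-- An orthonormal basis of Euclidean space whose first vector is the normalized all-ones vector. -/
lemma exists_orthonormalBasis_diagonal (n : ℕ) :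
    ∃ b : OrthonormalBasis (Fin (n + 1)) ℝ (EuclideanSpace ℝ (Fin (n + 1))),
      b 0 = WithLp.toLp 2 fun _ => (√(n + 1 : ℕ))⁻¹ := by
  set u : EuclideanSpace ℝ (Fin (n + 1)) := WithLp.toLp 2 fun _ => (√(n + 1 : ℕ))⁻¹ with hu
  have hnorm : ‖u‖ = 1 := by
    have : (0 : ℝ) < (n : ℝ) + 1 := by positivity
    simp [hu, EuclideanSpace.norm_eq, Real.sq_sqrt this.le, this.ne']
  have hv : Orthonormal ℝ
      (({0} : Set (Fin (n + 1))).domRestrict fun _ : Fin (n + 1) => u) := by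
    refine ⟨fun i => hnorm, fun i j hij => absurd (Subsingleton.elim i j) hij⟩
  obtain ⟨b, hb⟩ := hv.exists_orthonormalBasis_extension_of_card_eq (by simp)
  exact ⟨b, hb 0 rfl⟩

/-- In an orthonormal basis starting with the normalized all-ones vector, the scaled mean is the
first coordinate, and the sum of squared deviations is the sum of the squares of the others. -/
lemma meanAndDeviation_sum_smul {n : ℕ}
    (b : OrthonormalBasis (Fin (n + 1)) ℝ (EuclideanSpace ℝ (Fin (n + 1))))
    (hb : b 0 = WithLp.toLp 2 fun _ => (√(n + 1 : ℕ))⁻¹) (x : Fin (n + 1) → ℝ) :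
    meanAndDeviation (WithLp.ofLp (∑ i, x i • b i)) = (x 0, ∑ i : Fin n, x i.succ ^ 2) := by
  set e := ∑ i, x i • b i with he
  have hN : (0 : ℝ) < (n + 1 : ℕ) := by positivity
  have hfst : √(n + 1 : ℕ) * sampleMean e.ofLp = x 0 := by
    have h1 : inner ℝ (b 0) e = x 0 := b.orthonormal.inner_right_fintype x 0
    rw [← h1, hb, PiLp.inner_apply, sampleMean]
    simp only [RCLike.inner_apply, conj_trivial, ← Finset.sum_mul]
    have hs := Real.sq_sqrt hN.le
    have : √((n + 1 : ℕ) : ℝ) ≠ 0 := (Real.sqrt_pos.2 hN).ne'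
    field_simp
    rw [hs, mul_comm]
  have hnorm : ∑ k, e k ^ 2 = ∑ i, x i ^ 2 := by
    rw [← EuclideanSpace.real_norm_sq_eq, he, ← real_inner_self_eq_norm_sq,
      b.orthonormal.inner_sum]
    simp [sq]
  refine Prod.ext hfst ?_
  simp only [meanAndDeviation]
  rw [sum_sq_sub_sampleMean n.succ_ne_zero, hnorm, Fin.sum_univ_succ, ← hfst, mul_pow,
    Real.sq_sqrt hN.le]
  ring

/-- Fisher's theorem: for a standard normal sample, the scaled mean is standard normal, the sum of
squared deviations is chi-square with one degree of freedom less than the sample size, and the two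
are independent. -/
theorem map_meanAndDeviation (n : ℕ) :
    (Measure.pi fun _ : Fin (n + 1) => gaussianReal 0 1).map meanAndDeviation
      = (gaussianReal 0 1).prod (chiSquare n) := by
  obtain ⟨b, hb⟩ := exists_orthonormalBasis_diagonal n
  have hrot : (Measure.pi fun _ : Fin (n + 1) => gaussianReal 0 1).map (WithLp.toLp 2) =
      (Measure.pi fun _ : Fin (n + 1) => gaussianReal 0 1).map fun x => ∑ i, x i • b i := by
    rw [map_pi_eq_stdGaussian, stdGaussian_eq_map_pi_orthonormalBasis b]
  have hF : Measurable fun e : EuclideanSpace ℝ (Fin (n + 1)) => meanAndDeviation e.ofLp :=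
    measurable_meanAndDeviation.comp (by fun_prop)
  have h := congrArg (Measure.map fun e => meanAndDeviation e.ofLp) hrot
  rw [Measure.map_map hF (by fun_prop), Measure.map_map hF (by fun_prop)] at h
  have hsplit := (measurePreserving_piFinSuccAbove
    (fun _ : Fin (n + 1) => gaussianReal 0 1) 0).map_eq
  calc (Measure.pi fun _ : Fin (n + 1) => gaussianReal 0 1).map meanAndDeviation
      = (Measure.pi fun _ : Fin (n + 1) => gaussianReal 0 1).map
          fun x => (x 0, ∑ i : Fin n, x i.succ ^ 2) := by
        rw [show (meanAndDeviation : (Fin (n + 1) → ℝ) → ℝ × ℝ) =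
          (fun e : EuclideanSpace ℝ (Fin (n + 1)) => meanAndDeviation e.ofLp) ∘ WithLp.toLp 2
            from rfl, h]
        congr 1
        funext x
        exact meanAndDeviation_sum_smul b hb x
    _ = ((gaussianReal 0 1).prod (Measure.pi fun _ : Fin n => gaussianReal 0 1)).map
          (Prod.map id fun z => ∑ i, z i ^ 2) := by
        rw [← hsplit, Measure.map_map (by fun_prop) (MeasurableEquiv.measurable _)]
        rfl
    _ = (gaussianReal 0 1).prod (chiSquare n) := by
        rw [← Measure.map_prod_map _ _ measurable_id measurable_sum_sq, Measure.map_id, chiSquare]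

/-! ### Affine reduction to a standard normal sample -/

lemma pi_gaussianReal_eq_map {ι : Type*} [Fintype ι] (μ : ℝ) (v : ℝ≥0) :
    (Measure.pi fun _ : ι => gaussianReal μ v) =
      (Measure.pi fun _ : ι => gaussianReal 0 1).map fun z k => μ + √v * z k := by
  have h1 : (gaussianReal 0 1).map (fun x => μ + √v * x) = gaussianReal μ v := by
    rw [← Function.comp_def (fun x => μ + x) (fun x => √(v : ℝ) * x),
      ← Measure.map_map (by fun_prop) (by fun_prop), gaussianReal_map_const_mul,
      gaussianReal_map_const_add]
    congr 1
    · simp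
    · ext; simp
  have : IsProbabilityMeasure ((gaussianReal 0 1).map fun x => μ + √v * x) := by
    rw [h1]; infer_instance
  have h := Measure.pi_map_pi (μ := fun _ : ι => gaussianReal 0 1)
    (f := fun _ x => μ + √v * x) (fun _ => by fun_prop)
  rw [h, h1]

lemma sampleMean_affine {N : ℕ} (hN : N ≠ 0) (a c : ℝ) (z : Fin N → ℝ) :
    sampleMean (fun k => a + c * z k) = a + c * sampleMean z := by
  have hN' : (N : ℝ) ≠ 0 := by exact_mod_cast hN
  simp only [sampleMean, Finset.sum_add_distrib, ← Finset.mul_sum, Finset.sum_const,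
    Finset.card_univ, Fintype.card_fin, nsmul_eq_mul]
  field_simp

lemma sampleVar_affine {N : ℕ} (hN : N ≠ 0) (a c : ℝ) (z : Fin N → ℝ) :
    sampleVar (fun k => a + c * z k) = c ^ 2 * sampleVar z := by
  simp only [sampleVar, sampleMean_affine hN, add_sub_add_left_eq_sub, ← mul_sub, mul_pow,
    ← Finset.mul_sum, mul_div_assoc]

/-! ### Coverage of the ambiguity set -/

lemma gaussianReal_mem_ambiguitySet_iff {N : ℕ} {δst δχ μ : ℝ} {v : ℝ≥0} {w : Fin N → ℝ} :
    gaussianReal μ v ∈ ambiguitySet δst δχ w ↔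
      meanLower δst w ≤ μ ∧ μ ≤ meanUpper δst w ∧
        varLower δχ w ≤ (v : ℝ) ∧ (v : ℝ) ≤ varUpper δχ w := by
  constructor
  · rintro ⟨m, v', h, hm⟩
    obtain ⟨rfl, rfl⟩ := gaussianReal_ext_iff.1 h
    exact hm
  · exact fun h => ⟨μ, v, rfl, h⟩

lemma measurableSet_gaussianReal_mem_ambiguitySet {N : ℕ} (δst δχ μ : ℝ) (v : ℝ≥0) :
    MeasurableSet {w : Fin N → ℝ | gaussianReal μ v ∈ ambiguitySet δst δχ w} := by
  simp only [gaussianReal_mem_ambiguitySet_iff]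
  have hm := measurable_sampleMean (N := N)
  have hv := measurable_sampleVar (N := N)
  have h₁ : Measurable (meanLower (N := N) δst) := by unfold meanLower; fun_prop
  have h₂ : Measurable (meanUpper (N := N) δst) := by unfold meanUpper; fun_prop
  have h₃ : Measurable (varLower (N := N) δχ) := by unfold varLower; fun_prop
  have h₄ : Measurable (varUpper (N := N) δχ) := by unfold varUpper; fun_prop
  exact (measurableSet_le h₁ measurable_const).inter <|
    (measurableSet_le measurable_const h₂).inter <|
    (measurableSet_le h₃ measurable_const).inter (measurableSet_le measurable_const h₄)

/-- The normal law of the sample lies in the ambiguity set as soon as the two pivotal quantities of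
the standardized sample, the sum of squared deviations and the Student ratio, lie between their
respective quantiles. -/
lemma mem_ambiguitySet_of_pivots {n : ℕ} (hn : 0 < n) {δst δχ μ : ℝ} {v : ℝ≥0}
    {z : Fin (n + 1) → ℝ}
    (hpos : 0 < (meanAndDeviation z).2)
    (hlow : 0 < upperQuantile (chiSquare n) (1 - δχ / 2))
    (h₁ : (meanAndDeviation z).2 ≤ upperQuantile (chiSquare n) (δχ / 2))
    (h₂ : upperQuantile (chiSquare n) (1 - δχ / 2) ≤ (meanAndDeviation z).2)
    (h₃ : (meanAndDeviation z).1 / √((meanAndDeviation z).2 / n)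
      ≤ upperQuantile (studentT n) (δst / 2))
    (h₄ : -upperQuantile (studentT n) (δst / 2)
      ≤ (meanAndDeviation z).1 / √((meanAndDeviation z).2 / n)) :
    gaussianReal μ v ∈ ambiguitySet δst δχ fun k => μ + √v * z k := by
  have hn' : (0 : ℝ) < n := by exact_mod_cast hn
  have hvar : sampleVar z = (meanAndDeviation z).2 / n := by
    simp [sampleVar, meanAndDeviation]
  have hvarpos : 0 < sampleVar z := by rw [hvar]; positivity
  have hdev : (meanAndDeviation z).2 = n * sampleVar z := by rw [hvar]; field_simp
  rw [← hvar, meanAndDeviation] at h₃ h₄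
  rw [hdev] at h₁ h₂ hpos
  have hs : 0 < √(sampleVar z) := Real.sqrt_pos.2 hvarpos
  have hN : 0 < √((n + 1 : ℕ) : ℝ) := Real.sqrt_pos.2 (by positivity)
  rw [div_le_iff₀ hs] at h₃
  rw [le_div_iff₀ hs] at h₄
  have hwidth : √((√(v : ℝ) ^ 2 * sampleVar z) / (n + 1 : ℕ)) =
      √(v : ℝ) * (√(sampleVar z) / √((n + 1 : ℕ) : ℝ)) := by
    rw [Real.sqrt_div (by positivity), Real.sqrt_mul (by positivity),
      Real.sqrt_sq (Real.sqrt_nonneg _), mul_div_assoc]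
  have h₃' : sampleMean z ≤ upperQuantile (studentT n) (δst / 2) *
      (√(sampleVar z) / √((n + 1 : ℕ) : ℝ)) := by
    rw [← mul_div_assoc, le_div_iff₀ hN]; linarith
  have h₄' : -(upperQuantile (studentT n) (δst / 2) *
      (√(sampleVar z) / √((n + 1 : ℕ) : ℝ))) ≤ sampleMean z := by
    rw [← mul_div_assoc, ← neg_div, div_le_iff₀ hN]; linarith
  have h₃'' := mul_le_mul_of_nonneg_left h₃' (Real.sqrt_nonneg v)
  have h₄'' := mul_le_mul_of_nonneg_left h₄' (Real.sqrt_nonneg v)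
  rw [gaussianReal_mem_ambiguitySet_iff]
  simp only [meanLower, meanUpper, varLower, varUpper, sampleMean_affine n.succ_ne_zero,
    sampleVar_affine n.succ_ne_zero, Nat.add_sub_cancel, hwidth]
  refine ⟨by linarith, by linarith, ?_, ?_⟩
  · rw [div_le_iff₀ (hpos.trans_le h₁), Real.sq_sqrt v.coe_nonneg]
    have := mul_le_mul_of_nonneg_left h₁ v.coe_nonneg
    push_cast; linarith
  · rw [le_div_iff₀ hlow, Real.sq_sqrt v.coe_nonneg]
    have := mul_le_mul_of_nonneg_left h₂ v.coe_nonneg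
    push_cast; linarith

/-- Union bound for the four tail events of the two pivotal quantities. -/
lemma measureReal_pivot_tails_le {n : ℕ} {δst δχ : ℝ}
    (hst : δst ∈ Set.Ioo (0 : ℝ) 1) (hχ : δχ ∈ Set.Ioo (0 : ℝ) 1) :
    ((gaussianReal 0 1).prod (chiSquare n)).real
      (((Prod.snd ⁻¹' Set.Ioi (upperQuantile (chiSquare n) (δχ / 2))) ∪
        (Prod.snd ⁻¹' Set.Iio (upperQuantile (chiSquare n) (1 - δχ / 2)))) ∪
       (((fun p : ℝ × ℝ => p.1 / √(p.2 / n)) ⁻¹'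
          Set.Ioi (upperQuantile (studentT n) (δst / 2))) ∪
        ((fun p : ℝ × ℝ => p.1 / √(p.2 / n)) ⁻¹'
          Set.Iio (-upperQuantile (studentT n) (δst / 2))))) ≤ δst + δχ := by
  obtain ⟨hst₀, hst₁⟩ := hst
  obtain ⟨hχ₀, hχ₁⟩ := hχ
  set Q := (gaussianReal 0 1).prod (chiSquare n)
  have hsnd : ∀ s : Set ℝ, MeasurableSet s →
      Q.real (Prod.snd ⁻¹' s) = (chiSquare n).real s := fun s hs =>
    measurePreserving_snd.measureReal_preimage hs.nullMeasurableSet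
  have hratio : ∀ s : Set ℝ, MeasurableSet s →
      Q.real ((fun p : ℝ × ℝ => p.1 / √(p.2 / n)) ⁻¹' s) = (studentT n).real s := fun s hs =>
    (map_measureReal_apply (measurable_studentRatio n) hs).symm
  refine (measureReal_union_le _ _).trans <| (add_le_add (measureReal_union_le _ _)
    (measureReal_union_le _ _)).trans ?_
  rw [hsnd _ measurableSet_Ioi, hsnd _ measurableSet_Iio, hratio _ measurableSet_Ioi,
    hratio _ measurableSet_Iio, studentT_Iio_neg]
  have h₁ := measureReal_Ioi_upperQuantile_le (P := chiSquare n) (p := δχ / 2) (by linarith)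
  have h₂ := measureReal_Iio_upperQuantile_le (P := chiSquare n) (p := 1 - δχ / 2) (by linarith)
  have h₃ := measureReal_Ioi_upperQuantile_le (P := studentT n) (p := δst / 2) (by linarith)
  linarith

end GaussianAmbiguity

open GaussianAmbiguity in
/-- `P` is the true (normal) distribution of the residuals and `w` the sample of `N` residuals,
drawn from the `N`-fold product of `P`. -/
theorem proposition1 (N : ℕ) (hN : 2 ≤ N) (δst δχ δ : ℝ)
    (hst : δst ∈ Set.Ioo (0 : ℝ) 1) (hχ : δχ ∈ Set.Ioo (0 : ℝ) 1) (hδ : δ = δst + δχ)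
    (μ : ℝ) (v : ℝ≥0) (P : Measure ℝ) (hP : P = gaussianReal μ v) :
    MeasurableSet {w : Fin N → ℝ | P ∈ GaussianAmbiguity.ambiguitySet δst δχ w} ∧
    (Measure.pi (fun _ : Fin N => P)).real
      {w : Fin N → ℝ | P ∈ GaussianAmbiguity.ambiguitySet δst δχ w} ≥ 1 - δ := by
  subst hP hδ
  have hmeas := measurableSet_gaussianReal_mem_ambiguitySet (N := N) δst δχ μ v
  refine ⟨hmeas, ?_⟩
  obtain ⟨n, rfl⟩ : ∃ n, N = n + 1 := ⟨N - 1, by omega⟩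
  have hn : 0 < n := by omega
  have htails := measureReal_pivot_tails_le (n := n) hst hχ
  obtain ⟨hχ₀, hχ₁⟩ := hχ
  have hlow : 0 < upperQuantile (chiSquare n) (1 - δχ / 2) :=
    upperQuantile_pos (chiSquare_pos_ae hn) (by linarith) (by linarith)
  set B := ((Prod.snd ⁻¹' Set.Ioi (upperQuantile (chiSquare n) (δχ / 2))) ∪
        (Prod.snd ⁻¹' Set.Iio (upperQuantile (chiSquare n) (1 - δχ / 2)))) ∪
       (((fun p : ℝ × ℝ => p.1 / √(p.2 / n)) ⁻¹'
          Set.Ioi (upperQuantile (studentT n) (δst / 2))) ∪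
        ((fun p : ℝ × ℝ => p.1 / √(p.2 / n)) ⁻¹'
          Set.Iio (-upperQuantile (studentT n) (δst / 2)))) with hB
  have hBmeas : MeasurableSet B :=
    ((measurable_snd measurableSet_Ioi).union (measurable_snd measurableSet_Iio)).union
      ((measurable_studentRatio n measurableSet_Ioi).union
        (measurable_studentRatio n measurableSet_Iio))
  rw [← map_meanAndDeviation, map_measureReal_apply measurable_meanAndDeviation hBmeas] at htails
  have hcompl := probReal_compl_eq_one_sub
    (μ := Measure.pi fun _ : Fin (n + 1) => gaussianReal 0 1)
    (measurable_meanAndDeviation hBmeas)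
  rw [pi_gaussianReal_eq_map, map_measureReal_apply (by fun_prop) hmeas]
  refine le_trans ?_ (measureReal_mono (s₁ := (meanAndDeviation ⁻¹' B)ᶜ) fun z hz => ?_)
  · linarith
  · simp only [hB, Set.mem_compl_iff, Set.mem_preimage, Set.mem_union, Set.mem_Ioi, Set.mem_Iio,
      not_or, not_lt] at hz
    obtain ⟨⟨h₁, h₂⟩, h₃, h₄⟩ := hz
    exact mem_ambiguitySet_of_pivots hn (hlow.trans_le h₂) hlow h₁ h₂ h₃ h₄
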